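/- Let $\Theta$ be a topological space with Borel $\sigma$-field $\mathcal B$, let $\mathcal P(\Theta)$ be the set of probability measures on $(\Theta,\mathcal B)$ with the topology of weak convergence, and give $\mathcal P(\Theta)^2$ the product topology. Let $\alpha>0$ and let $P_0\in\mathcal P(\Theta)$ have full support, i.e. its topological support is $\Theta$. Let $v_j$, $j\ge 1$, be i.i.d. $\mathrm{Beta}(1,\alpha)$ and $\theta_j$, $j\ge1$, be i.i.d. $P_0$, with the sequences $(v_j)_j$ and $(\theta_j)_j$ independent of each other. Let $\ell_{j,g}$, $j\ge1$, $g=1,2$, be random variables with values in $\{0,1\}$ such that almost surely $\sum_{j}\ell_{j,g}=\infty$ for $g=1,2$; suppose that the whole array $(\ell_{j,g})$ is independent of $\big((v_j)_j,(\theta_j)_j\big)$ and that, for every $k\in\mathbb N$, $$\mathbb P\big(\ell_{j,1}=1,\ \ell_{j,2}=0 \text{ for } 1\le j\le k,\ \text{ and } \ell_{j,2}=1 \text{ for } k<j\le 2k\big)>0 .$$ Then, almost surely, for $g=1,2$, $$p_g=\sum_{j\ge1}\Big[v_j\ell_{j,g}\prod_{h<j}(1-v_h\ell_{h,g})\Big]\delta_{\theta_j}$$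 is a probability measure, and the vector $p_{1:2}=(p_1,p_2)$ (the thinned dependent Dirichlet process with parameters $\alpha$, $P_0$, $\ell_{1:2}$) has full weak support: the smallest closed subset of $\mathcal P(\Theta)^2$ which contains $p_{1:2}$ with probability one is $\mathcal P(\Theta)^2$ itself. If moreover $\Theta$ is separable and metrizable, then $p_{1:2}$ is (up to a null set) a measurable map into $\mathcal P(\Theta)^2$ with its Borel $\sigma$-field. -/

import Mathlib

open MeasureTheory ProbabilityTheory Set
open scoped ENNReal

noncomputable section

/-- The `j`-th (counting from `0`) thinned stick-breaking weight
`v_j ℓ_j ∏_{h<j} (1 - v_h ℓ_h)`. -/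
def thinnedWeight (v : ℕ → ℝ) (ℓ : ℕ → ℕ) (j : ℕ) : ℝ :=
  v j * (ℓ j : ℝ) * ∏ h ∈ Finset.range j, (1 - v h * (ℓ h : ℝ))

/-- The discrete measure `∑_j v_j ℓ_j ∏_{h<j} (1 - v_h ℓ_h) δ_{θ_j}`. -/
def thinnedMeasure {Θ : Type*} [MeasurableSpace Θ]
    (v : ℕ → ℝ) (θ : ℕ → Θ) (ℓ : ℕ → ℕ) : Measure Θ :=
  Measure.sum fun j => ENNReal.ofReal (thinnedWeight v ℓ j) • Measure.dirac (θ j)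

/-- The ingredients of the stick-breaking construction of a Dirichlet process: `v_j` i.i.d.
`Beta(1, α)` and `θ_j` i.i.d. `P₀`, the two sequences being independent of each other. -/
structure IsStickBreaking {Ω Θ : Type*} [MeasurableSpace Ω] [MeasurableSpace Θ]
    (μ : Measure Ω) (α : ℝ) (P₀ : Measure Θ) (v : ℕ → Ω → ℝ) (θ : ℕ → Ω → Θ) : Prop where
  measurable_v : ∀ j, Measurable (v j)
  measurable_θ : ∀ j, Measurable (θ j)
  law_v : ∀ j, μ.map (v j) = betaMeasure 1 α
  law_θ : ∀ j, μ.map (θ j) = P₀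
  indep_v : iIndepFun v μ
  indep_θ : iIndepFun θ μ
  indep : IndepFun (fun ω j => v j ω) (fun ω j => θ j ω) μ

/-- Random thinning sequences `ℓ_{j,g} ∈ {0,1}` with `∑_j ℓ_{j,g} = ∞` for each group `g`. -/
structure IsThinning {Ω : Type*} [MeasurableSpace Ω] {G : ℕ}
    (μ : Measure Ω) (ℓ : ℕ → Fin G → Ω → ℕ) : Prop where
  measurable : ∀ j g, Measurable (ℓ j g)
  zero_or_one : ∀ᵐ ω ∂μ, ∀ j g, ℓ j g ω = 0 ∨ ℓ j g ω = 1
  sum_eq_top : ∀ᵐ ω ∂μ, ∀ g, ∑' j, (ℓ j g ω : ℝ≥0∞) = ∞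

/-- `p` is the vector of random probability measures built from `v`, `θ` and `ℓ`: almost surely,
`p_g = ∑_j v_j ℓ_{j,g} ∏_{h<j} (1 - v_h ℓ_{h,g}) δ_{θ_j}` for every group `g`. -/
def IsThinnedDDPVector {Ω Θ : Type*} [MeasurableSpace Ω] [MeasurableSpace Θ] {G : ℕ}
    (μ : Measure Ω) (v : ℕ → Ω → ℝ) (θ : ℕ → Ω → Θ) (ℓ : ℕ → Fin G → Ω → ℕ)
    (p : Ω → Fin G → ProbabilityMeasure Θ) : Prop :=
  ∀ᵐ ω ∂μ, ∀ g, (p ω g : Measure Θ) =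
    thinnedMeasure (fun j => v j ω) (fun j => θ j ω) (fun j => ℓ j g ω)

/-- `S` is the weak support of the random vector `p`: the smallest set that is closed for the
product of the topologies of weak convergence and contains `p` with probability one. -/
def IsWeakSupport {Ω Θ : Type*} [MeasurableSpace Ω] [MeasurableSpace Θ] [TopologicalSpace Θ]
    [OpensMeasurableSpace Θ] {G : ℕ} (μ : Measure Ω) (p : Ω → Fin G → ProbabilityMeasure Θ)
    (S : Set (Fin G → ProbabilityMeasure Θ)) : Prop :=
  IsLeast {C | IsClosed C ∧ μ (p ⁻¹' C) = 1} S

end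

open Filter Topology BoundedContinuousFunction

/-! Thinning by `ℓ` just replaces the sticks `v_j` by `v_j ℓ_j`, so everything reduces to
stick-breaking with sticks in `[0,1]`. Support: a closed set of probability one other than the whole
space misses a product of two nonempty weakly open sets. Each of these contains a finitely supported
measure, which is itself a finite stick-breaking measure; hence open conditions on finitely many
sticks and atoms force membership, whatever follows (`exists_isOpen_stickMeasure_mem`). With
positive probability the thinning gives the first `k` sticks to group 0 alone and lets group 1 use
each of the next `k`. The two sets of conditions then concern disjoint blocks, and by independence,
positivity of the Beta density and full support of `P₀` they hold jointly with positive probability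
(`IsStickBreaking.measure_inter_pos`). Total mass one amounts to the unbroken remainder tending to
0, which follows from its expectation (`ae_tendsto_prod_one_sub_mul`). Measurability holds because
`p` is an a.s. limit of continuous functions of sticks and atoms. -/

/-- The stick-breaking weight `c_j ∏_{h<j} (1 - c_h)`. -/
noncomputable def stickWeight (c : ℕ → ℝ) (j : ℕ) : ℝ :=
  c j * ∏ h ∈ Finset.range j, (1 - c h)

/-- The discrete measure `∑_j c_j ∏_{h<j} (1 - c_h) δ_{θ_j}`. -/
noncomputable def stickMeasure {Θ : Type*} [MeasurableSpace Θ] (c : ℕ → ℝ) (θ : ℕ → Θ) :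
    Measure Θ :=
  Measure.sum fun j => ENNReal.ofReal (stickWeight c j) • Measure.dirac (θ j)

lemma thinnedMeasure_eq_stickMeasure {Θ : Type*} [MeasurableSpace Θ] (v : ℕ → ℝ) (θ : ℕ → Θ)
    (ℓ : ℕ → ℕ) : thinnedMeasure v θ ℓ = stickMeasure (fun j => v j * (ℓ j : ℝ)) θ := rfl

lemma sum_range_stickWeight (c : ℕ → ℝ) (n : ℕ) :
    ∑ j ∈ Finset.range n, stickWeight c j = 1 - ∏ j ∈ Finset.range n, (1 - c j) := by
  induction n with
  | zero => simp
  | succ n ih =>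
    rw [Finset.sum_range_succ, ih, Finset.prod_range_succ, stickWeight]
    ring

lemma stickWeight_congr {c c' : ℕ → ℝ} {n : ℕ} (h : ∀ j < n, c j = c' j) {j : ℕ} (hj : j < n) :
    stickWeight c j = stickWeight c' j := by
  unfold stickWeight
  rw [h j hj, Finset.prod_congr rfl fun i hi => by
    rw [h i ((Finset.mem_range.1 hi).trans hj)]]

lemma prod_range_one_sub_nonneg {c : ℕ → ℝ} (hc : ∀ j, c j ∈ Icc (0 : ℝ) 1) (n : ℕ) :
    0 ≤ ∏ j ∈ Finset.range n, (1 - c j) :=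
  Finset.prod_nonneg fun j _ => sub_nonneg.2 (hc j).2

lemma stickWeight_nonneg {c : ℕ → ℝ} (hc : ∀ j, c j ∈ Icc (0 : ℝ) 1) (j : ℕ) :
    0 ≤ stickWeight c j :=
  mul_nonneg (hc j).1 (prod_range_one_sub_nonneg hc j)

lemma antitone_prod_range_one_sub {c : ℕ → ℝ} (hc : ∀ j, c j ∈ Icc (0 : ℝ) 1) :
    Antitone fun n => ∏ j ∈ Finset.range n, (1 - c j) :=
  antitone_nat_of_succ_le fun n => by
    rw [Finset.prod_range_succ]
    exact mul_le_of_le_one_right (prod_range_one_sub_nonneg hc n) (by linarith [(hc n).1])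

lemma hasSum_stickWeight {c : ℕ → ℝ} (hc : ∀ j, c j ∈ Icc (0 : ℝ) 1)
    (h : Tendsto (fun n => ∏ j ∈ Finset.range n, (1 - c j)) atTop (𝓝 0)) :
    HasSum (stickWeight c) 1 := by
  rw [hasSum_iff_tendsto_nat_of_nonneg (stickWeight_nonneg hc)]
  simpa [sum_range_stickWeight] using h.const_sub 1

lemma continuous_stickWeight {X : Type*} [TopologicalSpace X] {c : X → ℕ → ℝ} {n j : ℕ}
    (hc : ∀ i < n, Continuous fun x => c x i) (hj : j < n) :
    Continuous fun x => stickWeight (c x) j :=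
  (hc j hj).mul <| continuous_finsetProd _ fun i hi =>
    continuous_const.sub (hc i ((Finset.mem_range.1 hi).trans hj))

/-! ### Stick-breaking measures and their integrals -/

section Measure

variable {Θ : Type*} [MeasurableSpace Θ]

lemma isProbabilityMeasure_stickMeasure {c : ℕ → ℝ} (hc : ∀ j, c j ∈ Icc (0 : ℝ) 1)
    (h : Tendsto (fun n => ∏ j ∈ Finset.range n, (1 - c j)) atTop (𝓝 0)) (θ : ℕ → Θ) :
    IsProbabilityMeasure (stickMeasure c θ) := by
  refine ⟨?_⟩
  have hs := hasSum_stickWeight hc h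
  simp [stickMeasure, Measure.sum_apply _ MeasurableSet.univ,
    ← ENNReal.ofReal_tsum_of_nonneg (stickWeight_nonneg hc) hs.summable, hs.tsum_eq]

/-- Zero sticks break nothing off, so the construction effectively starts at `m`. This lets group 1
ignore the block reserved for group 0. -/
lemma stickMeasure_eq_of_forall_lt_eq_zero {c : ℕ → ℝ} {m : ℕ} (h : ∀ j < m, c j = 0)
    (θ : ℕ → Θ) :
    stickMeasure c θ = stickMeasure (fun j => c (m + j)) (fun j => θ (m + j)) := by
  have h0 : ∀ j < m, stickWeight c j = 0 := fun j hj => by simp [stickWeight, h j hj]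
  have h1 : ∀ j, stickWeight c (m + j) = stickWeight (fun j => c (m + j)) j := fun j => by
    rw [stickWeight, stickWeight, Finset.prod_range_add,
      Finset.prod_eq_one fun i hi => by rw [h i (Finset.mem_range.1 hi), sub_zero], one_mul]
  ext s hs
  rw [stickMeasure, stickMeasure, Measure.sum_apply _ hs, Measure.sum_apply _ hs,
    ← ENNReal.summable.sum_add_tsum_nat_add' (k := m),
    Finset.sum_eq_zero fun i hi => by simp [h0 i (Finset.mem_range.1 hi)], zero_add]
  simp_rw [← h1, add_comm m]

variable [TopologicalSpace Θ] [OpensMeasurableSpace Θ]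

lemma hasSum_integral_stickMeasure {c : ℕ → ℝ} (hc : ∀ j, c j ∈ Icc (0 : ℝ) 1) (θ : ℕ → Θ)
    [IsProbabilityMeasure (stickMeasure c θ)] (f : Θ →ᵇ ℝ) :
    HasSum (fun j => stickWeight c j * f (θ j)) (∫ x, f x ∂stickMeasure c θ) := by
  have hf : Integrable f (stickMeasure c θ) := f.integrable _
  have h := hasSum_integral_measure hf
  have hd : ∀ j, ∫ x, f x ∂Measure.dirac (θ j) = f (θ j) := fun j =>
    integral_dirac' _ _ f.continuous.measurable.stronglyMeasurable
  simp only [integral_smul_measure, hd, ENNReal.toReal_ofReal (stickWeight_nonneg hc _),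
    smul_eq_mul] at h
  exact h

lemma abs_integral_stickMeasure_sub_sum_le {c : ℕ → ℝ} (hc : ∀ j, c j ∈ Icc (0 : ℝ) 1)
    (θ : ℕ → Θ) [IsProbabilityMeasure (stickMeasure c θ)] (f : Θ →ᵇ ℝ) (n : ℕ) :
    |∫ x, f x ∂stickMeasure c θ - ∑ j ∈ Finset.range n, stickWeight c j * f (θ j)| ≤
      ‖f‖ * ∏ j ∈ Finset.range n, (1 - c j) := by
  -- Testing against the constant 1 turns total mass one into exhaustion of the stick; the tail
  -- weights then sum to the remainder.
  have h1 : HasSum (stickWeight c) 1 := by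
    simpa using hasSum_integral_stickMeasure hc θ (BoundedContinuousFunction.const Θ (1 : ℝ))
  have hf := hasSum_integral_stickMeasure hc θ f
  have h1' := (hasSum_nat_add_iff' n).2 h1
  have hf' := (hasSum_nat_add_iff' n).2 hf
  rw [sum_range_stickWeight, sub_sub_cancel] at h1'
  have hb : ∀ j, |stickWeight c (j + n) * f (θ (j + n))| ≤ ‖f‖ * stickWeight c (j + n) :=
    fun j => by
      rw [abs_mul, abs_of_nonneg (stickWeight_nonneg hc _), mul_comm]
      exact mul_le_mul_of_nonneg_right (f.norm_coe_le_norm _) (stickWeight_nonneg hc _)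
  rw [← hf'.tsum_eq]
  exact tsum_of_norm_bounded (f := fun j => stickWeight c (j + n) * f (θ (j + n)))
    (h1'.mul_left ‖f‖) hb

end Measure

/-! ### Weak neighbourhoods and finite stick-breaking -/

section WeakTopology

variable {Θ : Type*} [MeasurableSpace Θ] [TopologicalSpace Θ] [OpensMeasurableSpace Θ]

lemma isInducing_integral_boundedContinuousFunction :
    IsInducing fun (P : ProbabilityMeasure Θ) (f : Θ →ᵇ ℝ) => ∫ x, f x ∂(P : Measure Θ) := by
  refine isInducing_iff_nhds.2 fun P => le_antisymm ?_ ?_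
  · refine Tendsto.le_comap ?_
    rw [tendsto_pi_nhds]
    exact ProbabilityMeasure.tendsto_iff_forall_integral_tendsto.1 tendsto_id
  · have h : Tendsto id (comap (fun (P : ProbabilityMeasure Θ) (f : Θ →ᵇ ℝ) =>
        ∫ x, f x ∂(P : Measure Θ)) (𝓝 fun f => ∫ x, f x ∂(P : Measure Θ))) (𝓝 P) :=
      ProbabilityMeasure.tendsto_iff_forall_integral_tendsto.2
        (tendsto_pi_nhds.1 tendsto_comap)
    exact h

lemma exists_finset_forall_abs_integral_sub_lt_mem {U : Set (ProbabilityMeasure Θ)}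
    (hU : IsOpen U) {P : ProbabilityMeasure Θ} (hP : P ∈ U) :
    ∃ (s : Finset (Θ →ᵇ ℝ)) (ε : ℝ), 0 < ε ∧ ∀ Q : ProbabilityMeasure Θ,
      (∀ f ∈ s, |∫ x, f x ∂(Q : Measure Θ) - ∫ x, f x ∂(P : Measure Θ)| < ε) → Q ∈ U := by
  obtain ⟨W, hW, rfl⟩ := isInducing_integral_boundedContinuousFunction.isOpen_iff.1 hU
  obtain ⟨s, u, hu, hsub⟩ := isOpen_pi_iff.1 hW _ hP
  have hball : ∀ f ∈ s, ∃ ε > 0, Metric.ball (∫ x, f x ∂(P : Measure Θ)) ε ⊆ u f :=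
    fun f hf => Metric.isOpen_iff.1 (hu f hf).1 _ (hu f hf).2
  choose! e he heu using hball
  obtain ⟨ε, hε, hεe⟩ : ∃ ε > 0, ∀ f ∈ s, ε ≤ e f := by
    rcases s.eq_empty_or_nonempty with rfl | hs
    · exact ⟨1, one_pos, by simp⟩
    · exact ⟨s.inf' hs e, (Finset.lt_inf'_iff hs).2 he, fun f hf => Finset.inf'_le _ hf⟩
  refine ⟨s, ε, hε, fun Q hQ => hsub fun f hf => heu f hf ?_⟩
  rw [Metric.mem_ball, Real.dist_eq]
  exact (hQ f hf).trans_le (hεe f hf)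

/-- The vector of integrals is the mean of `F`, hence lies in the closed convex hull of its range; a
nearby convex combination supplies weights and atoms. -/
lemma exists_weights_abs_sum_sub_integral_lt (P : ProbabilityMeasure Θ) (s : Finset (Θ →ᵇ ℝ))
    {ε : ℝ} (hε : 0 < ε) :
    ∃ (n : ℕ) (w : ℕ → ℝ) (x : ℕ → Θ), (∀ j, 0 ≤ w j) ∧ ∑ j ∈ Finset.range n, w j = 1 ∧
      (∀ j, n ≤ j → w j = 0) ∧
      ∀ f ∈ s, |∑ j ∈ Finset.range n, w j * f (x j) - ∫ x, f x ∂(P : Measure Θ)| < ε := by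
  have := P.nonempty
  let F : Θ → s → ℝ := fun x f => f.1 x
  have hFi : Integrable F (P : Measure Θ) := Integrable.of_eval fun f => f.1.integrable _
  have hmem : ∫ x, F x ∂(P : Measure Θ) ∈ closure (convexHull ℝ (range F)) :=
    (convex_convexHull ℝ _).closure.integral_mem isClosed_closure
      (ae_of_all _ fun x => subset_closure (subset_convexHull ℝ _ (mem_range_self x))) hFi
  obtain ⟨y, hy, hyd⟩ := Metric.mem_closure_iff.1 hmem ε hε
  obtain ⟨ι, _, w, z, hw0, hw1, hz, rfl⟩ := mem_convexHull_iff_exists_fintype.1 hy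
  choose x hx using hz
  let e := Fintype.equivFin ι
  let w' : ℕ → ℝ := fun j => if h : j < Fintype.card ι then w (e.symm ⟨j, h⟩) else 0
  let x' : ℕ → Θ := fun j => if h : j < Fintype.card ι then x (e.symm ⟨j, h⟩) else
    Classical.arbitrary Θ
  have hsum : ∀ g : Θ → ℝ, ∑ j ∈ Finset.range (Fintype.card ι), w' j * g (x' j) =
      ∑ i, w i * g (x i) := fun g => by
    rw [← Fin.sum_univ_eq_sum_range fun j => w' j * g (x' j)]
    rw [← e.symm.sum_comp]
    simp [w', x']
  refine ⟨Fintype.card ι, w', x', fun j => ?_, ?_, fun j hj => ?_, fun f hf => ?_⟩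
  · dsimp only [w']
    split_ifs
    exacts [hw0 _, le_rfl]
  · simpa [hw1] using hsum fun _ => 1
  · simp [w', hj]
  · rw [hsum f, abs_sub_comm]
    have h1 := (dist_le_pi_dist _ _ (⟨f, hf⟩ : s)).trans_lt hyd
    rw [Real.dist_eq] at h1
    have h2 : (∫ x, F x ∂(P : Measure Θ)) ⟨f, hf⟩ = ∫ x, f x ∂(P : Measure Θ) :=
      eval_integral (f := F) (fun g => g.1.integrable _) ⟨f, hf⟩
    simpa [h2, ← hx, F, Finset.sum_apply] using h1

/-- Every finite sequence of weights with total mass one comes from breaking a stick. -/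
lemma exists_stickWeight_eq {n : ℕ} {w : ℕ → ℝ} (h0 : ∀ j, 0 ≤ w j)
    (h1 : ∑ j ∈ Finset.range n, w j = 1) (hn : ∀ j, n ≤ j → w j = 0) :
    ∃ c : ℕ → ℝ, (∀ j, c j ∈ Icc (0 : ℝ) 1) ∧ ∀ j, stickWeight c j = w j := by
  have hle : ∀ k, ∑ j ∈ Finset.range k, w j ≤ 1 := fun k => by
    rcases le_total k n with hk | hk
    · rw [← h1]
      exact Finset.sum_le_sum_of_subset_of_nonneg (Finset.range_mono hk) fun j _ _ => h0 j
    · rw [← Finset.sum_subset (Finset.range_mono hk), h1]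
      exact fun j _ hj => hn j (by simpa using hj)
  let c : ℕ → ℝ := fun j => w j / (1 - ∑ i ∈ Finset.range j, w i)
  have hle' : ∀ j, w j ≤ 1 - ∑ i ∈ Finset.range j, w i := fun j => by
    have := hle (j + 1)
    rw [Finset.sum_range_succ] at this
    linarith
  have hcw : ∀ j, c j * (1 - ∑ i ∈ Finset.range j, w i) = w j := fun j => by
    -- Once nothing is left, `c j` is a division by zero, but `w j` vanishes too.
    rcases eq_or_ne (1 - ∑ i ∈ Finset.range j, w i) 0 with h | h
    · rw [h, mul_zero]
      exact le_antisymm (h0 j) (h ▸ hle' j)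
    · exact div_mul_cancel₀ _ h
  have hprod : ∀ k, ∏ j ∈ Finset.range k, (1 - c j) = 1 - ∑ j ∈ Finset.range k, w j := fun k => by
    induction k with
    | zero => simp
    | succ k ih =>
      rw [Finset.prod_range_succ, ih, Finset.sum_range_succ, mul_sub, mul_one, mul_comm _ (c k), hcw]
      ring
  refine ⟨c, fun j => ⟨div_nonneg (h0 j) ((h0 j).trans (hle' j)),
    div_le_one_of_le₀ (hle' j) ((h0 j).trans (hle' j))⟩, fun j => ?_⟩
  rw [stickWeight, hprod, hcw]

/-- Membership of a stick-breaking measure in a weak neighbourhood is forced by open conditions on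
finitely many sticks and atoms. -/
lemma exists_isOpen_stickMeasure_mem {U : Set (ProbabilityMeasure Θ)} (hU : IsOpen U)
    (hne : U.Nonempty) :
    ∃ (n : ℕ) (V : ℕ → Set ℝ) (T : ℕ → Set Θ),
      (∀ j, IsOpen (V j) ∧ (V j ∩ Icc 0 1).Nonempty) ∧ (∀ j, IsOpen (T j) ∧ (T j).Nonempty) ∧
      ∀ (c : ℕ → ℝ) (θ : ℕ → Θ), (∀ j, c j ∈ Icc (0 : ℝ) 1) →
        (∀ j < n, c j ∈ V j ∧ θ j ∈ T j) →
        ∀ Q : ProbabilityMeasure Θ, (Q : Measure Θ) = stickMeasure c θ → Q ∈ U := by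
  classical
  obtain ⟨P, hP⟩ := hne
  obtain ⟨s, ε, hε, hs⟩ := exists_finset_forall_abs_integral_sub_lt_mem hU hP
  obtain ⟨n, w, x, hw0, hw1, hwn, hwx⟩ := exists_weights_abs_sum_sub_integral_lt P s hε
  obtain ⟨c₀, hc₀, hcw⟩ := exists_stickWeight_eq hw0 hw1 hwn
  have hr₀ : ∏ j ∈ Finset.range n, (1 - c₀ j) = 0 := by
    have := sum_range_stickWeight c₀ n
    simp only [hcw, hw1] at this
    linarith
  -- The second summand bounds the contribution of all later sticks; it vanishes at the target,
  -- whose stick is used up by step `n`.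
  let O : Set ((ℕ → ℝ) × (ℕ → Θ)) := ⋂ f ∈ s, {q |
    |∑ j ∈ Finset.range n, stickWeight q.1 j * f (q.2 j) - ∫ x, f x ∂(P : Measure Θ)| +
      ‖f‖ * ∏ j ∈ Finset.range n, (1 - q.1 j) < ε}
  have hO : IsOpen O := by
    refine isOpen_biInter_finset fun f _ => isOpen_lt ?_ continuous_const
    unfold stickWeight
    fun_prop
  have hmem : (c₀, x) ∈ O := by
    simp only [O, mem_iInter₂, mem_ofPred_eq, hr₀, hcw, mul_zero, add_zero]
    exact hwx
  obtain ⟨A, B, hA, hB, hcA, hxB, hAB⟩ := isOpen_prod_iff.1 hO _ _ hmem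
  obtain ⟨I, u, hu, huA⟩ := isOpen_pi_iff.1 hA _ hcA
  obtain ⟨J, t, ht, htB⟩ := isOpen_pi_iff.1 hB _ hxB
  refine ⟨n, fun j => if j ∈ I then u j else univ, fun j => if j ∈ J then t j else univ,
    fun j => ?_, fun j => ?_, fun c θ hc h Q hQ => hs Q fun f hf => ?_⟩
  · dsimp only
    split_ifs with hj
    exacts [⟨(hu j hj).1, c₀ j, (hu j hj).2, hc₀ j⟩, ⟨isOpen_univ, c₀ j, mem_univ _, hc₀ j⟩]
  · dsimp only
    split_ifs with hj
    exacts [⟨(ht j hj).1, x j, (ht j hj).2⟩, ⟨isOpen_univ, x j, mem_univ _⟩]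
  -- `I` and `J` may contain indices beyond `n`; patching with the target there is harmless, as `O`
  -- sees only the first `n` coordinates.
  · let c' : ℕ → ℝ := fun j => if j < n then c j else c₀ j
    let θ' : ℕ → Θ := fun j => if j < n then θ j else x j
    have hc' : ∀ j < n, c' j = c j := fun j hj => if_pos hj
    have hθ' : ∀ j < n, θ' j = θ j := fun j hj => if_pos hj
    have hc'A : c' ∈ A := huA fun j hj => by
      by_cases hjn : j < n
      · rw [hc' j hjn]
        simpa [Finset.mem_coe.1 hj] using (h j hjn).1
      · simpa [c', hjn] using (hu j hj).2
    have hθ'B : θ' ∈ B := htB fun j hj => by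
      by_cases hjn : j < n
      · rw [hθ' j hjn]
        simpa [Finset.mem_coe.1 hj] using (h j hjn).2
      · simpa [θ', hjn] using (ht j hj).2
    have hmem' := mem_iInter₂.1 (hAB (mk_mem_prod hc'A hθ'B)) f hf
    simp only [mem_ofPred_eq] at hmem'
    rw [Finset.sum_congr rfl fun j hj => by
        rw [stickWeight_congr hc' (Finset.mem_range.1 hj), hθ' j (Finset.mem_range.1 hj)],
      Finset.prod_congr rfl fun j hj => by rw [hc' j (Finset.mem_range.1 hj)]] at hmem'
    have : IsProbabilityMeasure (stickMeasure c θ) := hQ ▸ inferInstance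
    have hb := abs_integral_stickMeasure_sub_sum_le hc θ f n
    rw [hQ]
    calc _ ≤ _ := abs_sub_le _ (∑ j ∈ Finset.range n, stickWeight c j * f (θ j)) _
      _ ≤ _ := add_le_add_left hb _
      _ < ε := by rwa [add_comm]

end WeakTopology

/-! ### Beta distributions -/

section Beta

variable {a b : ℝ}

lemma measurable_betaPDF (a b : ℝ) : Measurable (betaPDF a b) :=
  (measurable_betaPDFReal a b).ennreal_ofReal

lemma ae_betaMeasure_mem_Ioo (a b : ℝ) : ∀ᵐ x ∂betaMeasure a b, x ∈ Ioo (0 : ℝ) 1 := by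
  rw [betaMeasure, ae_withDensity_iff (measurable_betaPDF a b)]
  refine ae_of_all _ fun x hx => ?_
  by_contra h
  exact hx ((betaPDF_eq a b x).trans (by rw [if_neg (show ¬(0 < x ∧ x < 1) from h),
    ENNReal.ofReal_zero]))

/-- The closed interval is needed because target sticks may equal 0 or 1; an open set meeting it
also meets `(0,1)`, where the density is positive. -/
lemma betaMeasure_pos_of_isOpen (ha : 0 < a) (hb : 0 < b) {V : Set ℝ} (hV : IsOpen V)
    (hne : (V ∩ Icc 0 1).Nonempty) : 0 < betaMeasure a b V := by
  obtain ⟨x, hxV, hx⟩ := hne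
  rw [← closure_Ioo zero_ne_one] at hx
  have hne : (V ∩ Ioo 0 1).Nonempty := mem_closure_iff.1 hx V hV hxV
  have hpos : 0 < volume (V ∩ Ioo (0 : ℝ) 1) := (hV.inter isOpen_Ioo).measure_pos _ hne
  refine pos_iff_ne_zero.2 fun h0 => hpos.ne' ?_
  rw [betaMeasure, withDensity_apply_eq_zero (measurable_betaPDF a b)] at h0
  exact measure_mono_null (fun y hy =>
    And.intro (ENNReal.ofReal_pos.2 (betaPDFReal_pos hy.2.1 hy.2.2 ha hb)).ne' hy.1) h0

lemma integrable_id_betaMeasure (ha : 0 < a) (hb : 0 < b) :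
    Integrable (fun x : ℝ => x) (betaMeasure a b) := by
  have := isProbabilityMeasureBeta ha hb
  exact Integrable.of_mem_Icc 0 1 aemeasurable_id
    ((ae_betaMeasure_mem_Ioo a b).mono fun x hx => Ioo_subset_Icc_self hx)

lemma integral_id_betaMeasure_pos (ha : 0 < a) (hb : 0 < b) : 0 < ∫ x, x ∂betaMeasure a b := by
  have := isProbabilityMeasureBeta ha hb
  have h := ae_betaMeasure_mem_Ioo a b
  rw [integral_pos_iff_support_of_nonneg_ae (h.mono fun x hx => hx.1.le)
    (integrable_id_betaMeasure ha hb)]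
  have : (Function.support fun x : ℝ => x) ∈ ae (betaMeasure a b) := h.mono fun x hx => hx.1.ne'
  rw [prob_compl_eq_zero_iff₀ (by measurability) |>.1 this]
  exact one_pos

end Beta

/-! ### Exhaustion of the thinned stick -/

section Residual

variable {Ω : Type*} [MeasurableSpace Ω] {μ : Measure Ω} [IsProbabilityMeasure μ]

/-- If the bits `l` have infinite sum, the stick thinned by `l` is almost surely exhausted. -/
lemma ae_tendsto_prod_one_sub_mul_of_indep {v : ℕ → Ω → ℝ} {m : ℝ} (hv : ∀ j, Measurable (v j))
    (h01 : ∀ᵐ ω ∂μ, ∀ j, v j ω ∈ Icc (0 : ℝ) 1) (hind : iIndepFun v μ)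
    (hm : ∀ j, ∫ ω, v j ω ∂μ = m) (hm0 : 0 < m) {l : ℕ → ℕ} (hl : ∀ j, l j = 0 ∨ l j = 1)
    (hsum : ∑' j, (l j : ℝ≥0∞) = ∞) :
    ∀ᵐ ω ∂μ, Tendsto (fun n => ∏ j ∈ Finset.range n, (1 - v j ω * (l j : ℝ))) atTop (𝓝 0) := by
  have hc : ∀ᵐ ω ∂μ, ∀ j, v j ω * (l j : ℝ) ∈ Icc (0 : ℝ) 1 := by
    filter_upwards [h01] with ω hω j
    rcases hl j with h | h <;> simp only [h, Nat.cast_zero, Nat.cast_one, mul_zero, mul_one]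
    exacts [⟨le_rfl, zero_le_one⟩, hω j]
  have hvi : ∀ j, Integrable (v j) μ := fun j =>
    Integrable.of_mem_Icc 0 1 (hv j).aemeasurable (h01.mono fun ω h => h j)
  have hE : ∀ n, ∫ ω, ∏ j ∈ Finset.range n, (1 - v j ω * (l j : ℝ)) ∂μ =
      ∏ j ∈ Finset.range n, (1 - m * (l j : ℝ)) := fun n => by
    simp_rw [Finset.prod_range]
    rw [(hind.precomp Fin.val_injective).integral_fun_prod_comp
      (f := fun (i : Fin n) x => 1 - x * (l i : ℝ)) (fun i => (hv i).aemeasurable)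
      (fun i => by fun_prop)]
    refine Finset.prod_congr rfl fun i _ => ?_
    rw [integral_sub (integrable_const _) ((hvi i).mul_const _), integral_mul_const, hm]
    simp
  have hm1 : m ≤ 1 := by
    rw [← hm 0]
    calc _ ≤ ∫ _, (1 : ℝ) ∂μ := integral_mono_ae (hvi 0) (integrable_const _)
          (h01.mono fun ω h => (h 0).2)
      _ = 1 := by simp
  have hnn : ∀ j, 0 ≤ 1 - m * (l j : ℝ) := fun j => by
    rcases hl j with h | h <;> simp [h, hm1]
  have hS : Tendsto (fun n => ∑ j ∈ Finset.range n, (l j : ℝ)) atTop atTop := by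
    rw [← not_summable_iff_tendsto_nat_atTop_of_nonneg fun n => Nat.cast_nonneg _]
    intro h
    refine (ENNReal.tsum_coe_ne_top_iff_summable (f := fun j => (l j : NNReal))).2 ?_ (by simpa)
    exact NNReal.summable_coe.1 (by simpa using h)
  -- Bounded by `exp (-m ∑ l j)`. Vanishing expectations suffice since the remainders decrease.
  have hlim : Tendsto (fun n => ∏ j ∈ Finset.range n, (1 - m * (l j : ℝ))) atTop (𝓝 0) := by
    refine squeeze_zero (fun n => Finset.prod_nonneg fun j _ => hnn j) (fun n => ?_)
      (Real.tendsto_exp_neg_atTop_nhds_zero.comp (hS.const_mul_atTop hm0))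
    rw [Function.comp_apply, Finset.mul_sum, ← Finset.sum_neg_distrib, Real.exp_sum]
    exact Finset.prod_le_prod (fun j _ => hnn j) fun j _ => Real.one_sub_le_exp_neg _
  refine tendsto_of_integral_tendsto_of_antitone (F := fun _ => 0) (fun n => ?_)
    (integrable_zero _ _ _) (by simpa [hE] using hlim)
    (hc.mono fun ω h => antitone_prod_range_one_sub h)
    (hc.mono fun ω h n => prod_range_one_sub_nonneg h n)
  refine Integrable.of_mem_Icc 0 1 (by fun_prop) (hc.mono fun ω h => ⟨prod_range_one_sub_nonneg h n,
    ?_⟩)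
  simpa using antitone_prod_range_one_sub h n.zero_le

/-- Independence makes the joint law a product, so Fubini reduces to fixed bits. -/
lemma ae_tendsto_prod_one_sub_mul {v : ℕ → Ω → ℝ} {m : ℝ} (hv : ∀ j, Measurable (v j))
    (h01 : ∀ᵐ ω ∂μ, ∀ j, v j ω ∈ Icc (0 : ℝ) 1) (hind : iIndepFun v μ)
    (hm : ∀ j, ∫ ω, v j ω ∂μ = m) (hm0 : 0 < m) {l : ℕ → Ω → ℕ} (hlm : ∀ j, Measurable (l j))
    (hl : ∀ᵐ ω ∂μ, ∀ j, l j ω = 0 ∨ l j ω = 1)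
    (hsum : ∀ᵐ ω ∂μ, ∑' j, (l j ω : ℝ≥0∞) = ∞)
    (hlv : IndepFun (fun ω j => l j ω) (fun ω j => v j ω) μ) :
    ∀ᵐ ω ∂μ, Tendsto (fun n => ∏ j ∈ Finset.range n, (1 - v j ω * (l j ω : ℝ))) atTop (𝓝 0) := by
  have hlm' : Measurable fun ω j => l j ω := measurable_pi_lambda _ hlm
  have hv' : Measurable fun ω j => v j ω := measurable_pi_lambda _ hv
  let p : (ℕ → ℕ) × (ℕ → ℝ) → Prop := fun q =>
    Tendsto (fun n => ∏ j ∈ Finset.range n, (1 - q.2 j * (q.1 j : ℝ))) atTop (𝓝 0)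
  have hp : MeasurableSet {q | p q} := measurableSet_tendsto _ fun n => by fun_prop
  have hgood : MeasurableSet {x : ℕ → ℕ | (∀ j, x j = 0 ∨ x j = 1) ∧ ∑' j, (x j : ℝ≥0∞) = ∞} := by
    refine MeasurableSet.inter ?_ ?_
    · change MeasurableSet {x : ℕ → ℕ | ∀ j, x j = 0 ∨ x j = 1}
      rw [ofPred_forall]
      exact MeasurableSet.iInter fun j =>
        (measurable_pi_apply j) (t := {n | n = 0 ∨ n = 1}) (by measurability)
    · have : Measurable fun x : ℕ → ℕ => ∑' j, (x j : ℝ≥0∞) := by fun_prop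
      exact this (measurableSet_singleton _)
  have hjoint : ∀ᵐ q ∂μ.map (fun ω => ((fun j => l j ω), fun j => v j ω)), p q := by
    have := Measure.isProbabilityMeasure_map (μ := μ) hv'.aemeasurable
    rw [(indepFun_iff_map_prod_eq_prod_map_map hlm'.aemeasurable hv'.aemeasurable).1 hlv,
      Measure.ae_prod_iff_ae_ae hp]
    have hae := (ae_map_iff hlm'.aemeasurable hgood).2 (hl.and hsum)
    filter_upwards [hae] with x hx
    refine (ae_map_iff hv'.aemeasurable (measurable_prodMk_left hp)).2 ?_
    exact ae_tendsto_prod_one_sub_mul_of_indep hv h01 hind hm hm0 hx.1 hx.2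
  exact (ae_map_iff (hlm'.prodMk hv').aemeasurable hp).1 hjoint

end Residual

/-! ### Continuous approximation by truncated sticks -/

section Truncation

variable {Θ : Type*} [MeasurableSpace Θ]

/-- Stop breaking the stick at step `n` by using up all that is left. -/
noncomputable def truncateStick (n : ℕ) (c : ℕ → ℝ) (j : ℕ) : ℝ := if j < n then c j else 1

lemma truncateStick_mem_Icc {c : ℕ → ℝ} (hc : ∀ j, c j ∈ Icc (0 : ℝ) 1) (n j : ℕ) :
    truncateStick n c j ∈ Icc (0 : ℝ) 1 := by
  unfold truncateStick
  split_ifs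
  exacts [hc j, ⟨zero_le_one, le_rfl⟩]

lemma prod_range_truncateStick_eq_zero (n : ℕ) (c : ℕ → ℝ) {k : ℕ} (hk : n < k) :
    ∏ j ∈ Finset.range k, (1 - truncateStick n c j) = 0 :=
  Finset.prod_eq_zero (Finset.mem_range.2 hk) (by simp [truncateStick])

/-- The probability measure given by the stick-breaking measure with the stick exhausted at
step `n`. -/
noncomputable def truncatedStickMeasure (n : ℕ) (c : ℕ → Icc (0 : ℝ) 1) (θ : ℕ → Θ) :
    ProbabilityMeasure Θ :=
  ⟨stickMeasure (truncateStick n fun j => c j) θ,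
    isProbabilityMeasure_stickMeasure (truncateStick_mem_Icc (fun j => (c j).2) n)
      (tendsto_const_nhds.congr' ((eventually_gt_atTop n).mono fun _ hk =>
        (prod_range_truncateStick_eq_zero n _ hk).symm)) θ⟩

variable [TopologicalSpace Θ] [OpensMeasurableSpace Θ]

lemma continuous_truncatedStickMeasure (n : ℕ) :
    Continuous fun q : (ℕ → Icc (0 : ℝ) 1) × (ℕ → Θ) => truncatedStickMeasure n q.1 q.2 := by
  rw [ProbabilityMeasure.continuous_iff_forall_continuous_integral]
  intro f
  have h : ∀ q : (ℕ → Icc (0 : ℝ) 1) × (ℕ → Θ),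
      ∫ x, f x ∂(truncatedStickMeasure n q.1 q.2 : Measure Θ) = ∑ j ∈ Finset.range (n + 1),
        stickWeight (truncateStick n fun j => q.1 j) j * f (q.2 j) := fun q => by
    have hp : IsProbabilityMeasure (stickMeasure (truncateStick n fun j => q.1 j) q.2) :=
      (truncatedStickMeasure n q.1 q.2).2
    -- Stick `n` takes all that is left, so the sum over `n + 1` terms is exact.
    have hb := abs_integral_stickMeasure_sub_sum_le
      (truncateStick_mem_Icc (fun j => (q.1 j).2) n) q.2 f (n + 1)
    rw [prod_range_truncateStick_eq_zero n _ n.lt_succ_self, mul_zero] at hb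
    exact sub_eq_zero.1 (abs_nonpos_iff.1 hb)
  simp_rw [h]
  refine continuous_finsetSum _ fun j _ => Continuous.mul ?_ (by fun_prop)
  refine continuous_stickWeight (n := j + 1) (fun i _ => ?_) j.lt_succ_self
  unfold truncateStick
  split_ifs <;> fun_prop

lemma Continuous.truncatedStickMeasure {X : Type*} [TopologicalSpace X] (n : ℕ)
    {f : X → (ℕ → Icc (0 : ℝ) 1) × (ℕ → Θ)} (hf : Continuous f) :
    Continuous fun x => truncatedStickMeasure n (f x).1 (f x).2 :=
  (continuous_truncatedStickMeasure n).comp hf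

lemma continuous_truncatedStickMeasure_apply {G : ℕ} (n : ℕ) (g : Fin G) :
    Continuous fun q : (Fin G → ℕ → Icc (0 : ℝ) 1) × (ℕ → Θ) =>
      truncatedStickMeasure n (q.1 g) q.2 :=
  Continuous.truncatedStickMeasure n
    (f := fun q : (Fin G → ℕ → Icc (0 : ℝ) 1) × (ℕ → Θ) => (q.1 g, q.2)) (by fun_prop)

lemma continuous_truncatedStickMeasure_pi (G n : ℕ) :
    Continuous fun (q : (Fin G → ℕ → Icc (0 : ℝ) 1) × (ℕ → Θ)) (g : Fin G) =>
      truncatedStickMeasure n (q.1 g) q.2 :=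
  continuous_pi fun g => continuous_truncatedStickMeasure_apply n g

lemma tendsto_truncatedStickMeasure {c : ℕ → Icc (0 : ℝ) 1} {θ : ℕ → Θ}
    {Q : ProbabilityMeasure Θ} (hQ : (Q : Measure Θ) = stickMeasure (fun j => c j) θ)
    (h : Tendsto (fun n => ∏ j ∈ Finset.range n, (1 - (c j : ℝ))) atTop (𝓝 0)) :
    Tendsto (fun n => truncatedStickMeasure n c θ) atTop (𝓝 Q) := by
  rw [ProbabilityMeasure.tendsto_iff_forall_integral_tendsto]
  intro f
  have hp : IsProbabilityMeasure (stickMeasure (fun j => (c j : ℝ)) θ) := hQ ▸ inferInstance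
  -- Both measures share their first `n` terms; each tail costs one remainder.
  have h2 := (h.const_mul ‖f‖).const_mul 2
  rw [mul_zero, mul_zero] at h2
  refine tendsto_iff_dist_tendsto_zero.2 (squeeze_zero (fun _ => dist_nonneg) (fun n => ?_) h2)
  have hpn : IsProbabilityMeasure (stickMeasure (truncateStick n fun j => c j) θ) :=
    (truncatedStickMeasure n c θ).2
  have hcn : ∀ j < n, truncateStick n (fun j => (c j : ℝ)) j = c j := fun j hj => if_pos hj
  have h3 := abs_integral_stickMeasure_sub_sum_le (fun j => (c j).2) θ f n
  have h4 := abs_integral_stickMeasure_sub_sum_le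
    (truncateStick_mem_Icc (fun j => (c j).2) n) θ f n
  rw [Finset.sum_congr rfl fun j hj => by rw [stickWeight_congr hcn (Finset.mem_range.1 hj)],
    Finset.prod_congr rfl fun j hj => by rw [hcn j (Finset.mem_range.1 hj)]] at h4
  rw [Real.dist_eq, hQ]
  refine (abs_sub_le _ (∑ j ∈ Finset.range n, stickWeight (fun j => (c j : ℝ)) j * f (θ j)) _).trans
    ?_
  rw [abs_sub_comm _ (∫ x, f x ∂stickMeasure (fun j => (c j : ℝ)) θ), two_mul]
  exact add_le_add h4 h3

end Truncation

/-! ### Borel measurability of the random vector -/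

section Measurability

lemma aemeasurable_borel_of_tendsto_continuous_comp {Ω X β : Type*} [MeasurableSpace Ω]
    {μ : Measure Ω} [TopologicalSpace X] [MeasurableSpace X] [OpensMeasurableSpace X]
    [TopologicalSpace β] [TopologicalSpace.PseudoMetrizableSpace β] {F : ℕ → X → β}
    (hF : ∀ n, Continuous (F n)) {Y : Ω → X} (hY : Measurable Y) {p : Ω → β}
    (h : ∀ᵐ ω ∂μ, Tendsto (fun n => F n (Y ω)) atTop (𝓝 (p ω))) :
    @AEMeasurable Ω β (borel β) _ p μ := by
  borelize β
  exact aemeasurable_of_tendsto_metrizable_ae atTop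
    (fun n => ((hF n).measurable.comp hY).aemeasurable) h


variable {Ω Θ : Type*} [MeasurableSpace Ω] {μ : Measure Ω} [TopologicalSpace Θ] [MeasurableSpace Θ]
  [BorelSpace Θ]

lemma aemeasurable_borel_of_ae_eq_stickMeasure [TopologicalSpace.SeparableSpace Θ]
    [TopologicalSpace.MetrizableSpace Θ] {G : ℕ} {c : Ω → Fin G → ℕ → ℝ} {θ : Ω → ℕ → Θ}
    (hc : Measurable c) (hθ : Measurable θ)
    (h01 : ∀ᵐ ω ∂μ, ∀ g j, c ω g j ∈ Icc (0 : ℝ) 1)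
    (hlim : ∀ᵐ ω ∂μ, ∀ g,
      Tendsto (fun n => ∏ j ∈ Finset.range n, (1 - c ω g j)) atTop (𝓝 0))
    {p : Ω → Fin G → ProbabilityMeasure Θ}
    (hp : ∀ᵐ ω ∂μ, ∀ g, (p ω g : Measure Θ) = stickMeasure (c ω g) (θ ω)) :
    @AEMeasurable Ω (Fin G → ProbabilityMeasure Θ) (borel _) _ p μ := by
  -- Second countability makes the product σ-field on `ℕ → Θ` contain all open sets.
  have : SecondCountableTopology Θ := by
    let _ : MetricSpace Θ := TopologicalSpace.metrizableSpaceMetric Θ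
    exact UniformSpace.secondCountable_of_separable Θ
  let C : Ω → Fin G → ℕ → Icc (0 : ℝ) 1 := fun ω g j => projIcc 0 1 zero_le_one (c ω g j)
  have hC : Measurable C := by
    refine measurable_pi_lambda _ fun g => measurable_pi_lambda _ fun j => ?_
    exact continuous_projIcc.measurable.comp (by fun_prop)
  refine aemeasurable_borel_of_tendsto_continuous_comp
    (continuous_truncatedStickMeasure_pi G) (hC.prodMk hθ) ?_
  filter_upwards [h01, hlim, hp] with ω h1 h2 h3
  rw [tendsto_pi_nhds]
  intro g
  have hCc : (fun j => (C ω g j : ℝ)) = c ω g :=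
    funext fun j => congrArg Subtype.val (projIcc_of_mem zero_le_one (h1 g j))
  refine tendsto_truncatedStickMeasure (by rw [hCc, h3 g]) ?_
  have := h2 g
  rwa [← hCc] at this

end Measurability

/-! ### Positive probability of finite-dimensional events -/

section Support

variable {Ω Θ : Type*} [MeasurableSpace Ω] {μ : Measure Ω}

lemma iIndepFun.measure_biInter_preimage_pos {β : Type*} [MeasurableSpace β] {X : ℕ → Ω → β}
    (hX : iIndepFun X μ) {S : ℕ → Set β} (hS : ∀ j, MeasurableSet (S j))
    (hpos : ∀ j, 0 < μ (X j ⁻¹' S j)) (n : ℕ) : 0 < μ (⋂ j ∈ Finset.range n, X j ⁻¹' S j) := by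
  rw [hX.meas_biInter fun j _ => ⟨S j, hS j, rfl⟩]
  exact pos_iff_ne_zero.2 (Finset.prod_ne_zero_iff.2 fun j _ => (hpos j).ne')

variable [MeasurableSpace Θ] {α : ℝ} {P₀ : Measure Θ} {v : ℕ → Ω → ℝ} {θ : ℕ → Ω → Θ}

lemma IsStickBreaking.ae_mem_Icc (h : IsStickBreaking μ α P₀ v θ) :
    ∀ᵐ ω ∂μ, ∀ j, v j ω ∈ Icc (0 : ℝ) 1 := by
  rw [ae_all_iff]
  intro j
  refine (ae_map_iff (h.measurable_v j).aemeasurable measurableSet_Icc).1 ?_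
  rw [h.law_v j]
  exact (ae_betaMeasure_mem_Ioo 1 α).mono fun x hx => Ioo_subset_Icc_self hx

lemma IsStickBreaking.ae_tendsto_prod_one_sub_mul [IsProbabilityMeasure μ]
    (h : IsStickBreaking μ α P₀ v θ) (hα : 0 < α)
    {G : ℕ} {ℓ : ℕ → Fin G → Ω → ℕ} (hℓ : IsThinning μ ℓ)
    (hind : IndepFun (fun ω j g => ℓ j g ω) (fun ω => (fun j => v j ω, fun j => θ j ω)) μ) :
    ∀ᵐ ω ∂μ, ∀ g, Tendsto (fun n => ∏ j ∈ Finset.range n, (1 - v j ω * (ℓ j g ω : ℝ)))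
      atTop (𝓝 0) := by
  rw [ae_all_iff]
  intro g
  refine _root_.ae_tendsto_prod_one_sub_mul h.measurable_v h.ae_mem_Icc h.indep_v (fun j => ?_)
    (integral_id_betaMeasure_pos one_pos hα) (fun j => hℓ.measurable j g)
    (hℓ.zero_or_one.mono fun ω hω j => hω j g) (hℓ.sum_eq_top.mono fun ω hω => hω g)
    (hind.comp (φ := fun (a : ℕ → Fin G → ℕ) j => a j g) (ψ := Prod.fst) (by fun_prop)
      measurable_fst)
  rw [← h.law_v j, integral_map (h.measurable_v j).aemeasurable (by fun_prop)]

lemma ae_thinned_mem_Icc (h : IsStickBreaking μ α P₀ v θ) {G : ℕ} {ℓ : ℕ → Fin G → Ω → ℕ}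
    (hℓ : IsThinning μ ℓ) :
    ∀ᵐ ω ∂μ, ∀ g j, v j ω * (ℓ j g ω : ℝ) ∈ Icc (0 : ℝ) 1 := by
  filter_upwards [h.ae_mem_Icc, hℓ.zero_or_one] with ω h1 h2 g j
  rcases h2 j g with h | h <;> simp only [h, Nat.cast_zero, Nat.cast_one, mul_zero, mul_one]
  exacts [⟨le_rfl, zero_le_one⟩, h1 j]

lemma IsStickBreaking.measure_inter_pos [TopologicalSpace Θ] [OpensMeasurableSpace Θ]
    (h : IsStickBreaking μ α P₀ v θ) (hα : 0 < α) (hP₀ : P₀.support = univ)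
    {β : Type*} [MeasurableSpace β] {X : Ω → β}
    (hind : IndepFun X (fun ω => (fun j => v j ω, fun j => θ j ω)) μ) {S : Set β}
    (hS : MeasurableSet S) (hSpos : 0 < μ (X ⁻¹' S)) {V : ℕ → Set ℝ} {T : ℕ → Set Θ}
    (hV : ∀ j, IsOpen (V j) ∧ (V j ∩ Icc 0 1).Nonempty)
    (hT : ∀ j, IsOpen (T j) ∧ (T j).Nonempty) (n : ℕ) :
    0 < μ {ω | X ω ∈ S ∧ ∀ j < n, v j ω ∈ V j ∧ θ j ω ∈ T j} := by
  have hv := iIndepFun.measure_biInter_preimage_pos h.indep_v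
    (fun j => (hV j).1.measurableSet) (fun j => by
      rw [← Measure.map_apply (h.measurable_v j) (hV j).1.measurableSet, h.law_v j]
      exact betaMeasure_pos_of_isOpen one_pos hα (hV j).1 (hV j).2) n
  have hθ := iIndepFun.measure_biInter_preimage_pos h.indep_θ
    (fun j => (hT j).1.measurableSet) (fun j => by
      rw [← Measure.map_apply (h.measurable_θ j) (hT j).1.measurableSet, h.law_θ j]
      obtain ⟨x, hx⟩ := (hT j).2
      exact (Measure.mem_support_iff_forall x).1 (hP₀ ▸ mem_univ x) _ ((hT j).1.mem_nhds hx)) n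
  let A : Set (ℕ → ℝ) := ⋂ j ∈ Finset.range n, {x | x j ∈ V j}
  let B : Set (ℕ → Θ) := ⋂ j ∈ Finset.range n, {x | x j ∈ T j}
  have hA : MeasurableSet A := Finset.measurableSet_biInter _ fun j _ =>
    measurable_pi_apply j (hV j).1.measurableSet
  have hB : MeasurableSet B := Finset.measurableSet_biInter _ fun j _ =>
    measurable_pi_apply j (hT j).1.measurableSet
  have hset : {ω | X ω ∈ S ∧ ∀ j < n, v j ω ∈ V j ∧ θ j ω ∈ T j} =
      X ⁻¹' S ∩ (fun ω => (fun j => v j ω, fun j => θ j ω)) ⁻¹' (A ×ˢ B) := by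
    ext ω
    simp [A, B, forall_and]
  have hset' : (fun ω => (fun j => v j ω, fun j => θ j ω)) ⁻¹' (A ×ˢ B) =
      (fun ω j => v j ω) ⁻¹' A ∩ (fun ω j => θ j ω) ⁻¹' B := rfl
  have hvA : (fun ω j => v j ω) ⁻¹' A = ⋂ j ∈ Finset.range n, v j ⁻¹' V j := by
    simp only [A, preimage_iInter]
    rfl
  have hθB : (fun ω j => θ j ω) ⁻¹' B = ⋂ j ∈ Finset.range n, θ j ⁻¹' T j := by
    simp only [B, preimage_iInter]
    rfl
  rw [hset, hind.measure_inter_preimage_eq_mul _ _ hS (hA.prod hB), hset',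
    h.indep.measure_inter_preimage_eq_mul _ _ hA hB, hvA, hθB]
  exact ENNReal.mul_pos hSpos.ne' (ENNReal.mul_pos hv.ne' hθ.ne').ne'

end Support

/-! ### The main theorem -/

theorem proposition4
    {Ω Θ : Type*} [MeasurableSpace Ω] [TopologicalSpace Θ] [MeasurableSpace Θ] [BorelSpace Θ]
    (μ : Measure Ω) [IsProbabilityMeasure μ]
    (α : ℝ) (hα : 0 < α)
    (P₀ : Measure Θ) [IsProbabilityMeasure P₀] (hP₀ : P₀.support = Set.univ)
    (v : ℕ → Ω → ℝ) (θ : ℕ → Ω → Θ) (ℓ : ℕ → Fin 2 → Ω → ℕ)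
    (hvθ : IsStickBreaking μ α P₀ v θ)
    (hℓ : IsThinning μ ℓ)
    (hind : IndepFun (fun ω j g => ℓ j g ω) (fun ω => (fun j => v j ω, fun j => θ j ω)) μ)
    (hpos : ∀ k : ℕ, 0 < μ {ω | (∀ j, j < k → ℓ j 0 ω = 1 ∧ ℓ j 1 ω = 0) ∧
      (∀ j, k ≤ j → j < 2 * k → ℓ j 1 ω = 1)}) :
    -- the series almost surely define probability measures
    (∃ p : Ω → Fin 2 → ProbabilityMeasure Θ, IsThinnedDDPVector μ v θ ℓ p) ∧
    ∀ p : Ω → Fin 2 → ProbabilityMeasure Θ, IsThinnedDDPVector μ v θ ℓ p →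
      -- for separable metrizable `Θ`, `p` is a Borel random element
      (TopologicalSpace.SeparableSpace Θ → TopologicalSpace.MetrizableSpace Θ →
        @AEMeasurable Ω (Fin 2 → ProbabilityMeasure Θ) (borel _) _ p μ) ∧
      -- full weak support
      IsWeakSupport μ p Set.univ := by
  have h01 := ae_thinned_mem_Icc hvθ hℓ
  have hlim := hvθ.ae_tendsto_prod_one_sub_mul hα hℓ hind
  refine ⟨?_, fun p hp => ⟨fun _ _ => ?_, ⟨isClosed_univ, by simp⟩, fun C hC => ?_⟩⟩
  · have hex : ∀ ω g, ∃ Q : ProbabilityMeasure Θ,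
        IsProbabilityMeasure (stickMeasure (fun j => v j ω * (ℓ j g ω : ℝ)) fun j => θ j ω) →
          (Q : Measure Θ) = stickMeasure (fun j => v j ω * (ℓ j g ω : ℝ)) fun j => θ j ω :=
      fun ω g => by
        by_cases h : IsProbabilityMeasure
          (stickMeasure (fun j => v j ω * (ℓ j g ω : ℝ)) fun j => θ j ω)
        exacts [⟨⟨_, h⟩, fun _ => rfl⟩, ⟨⟨P₀, inferInstance⟩, fun h' => absurd h' h⟩]
    choose p hp using hex
    refine ⟨p, ?_⟩
    filter_upwards [h01, hlim] with ω h1 h2 g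
    exact hp ω g (isProbabilityMeasure_stickMeasure (h1 g) (h2 g) _)
  · refine aemeasurable_borel_of_ae_eq_stickMeasure
      (c := fun ω g j => v j ω * (ℓ j g ω : ℝ)) (θ := fun ω j => θ j ω)
      ?_ (measurable_pi_lambda _ hvθ.measurable_θ) h01 hlim hp
    exact measurable_pi_lambda _ fun g => measurable_pi_lambda _ fun j =>
      (hvθ.measurable_v j).mul (measurable_from_nat.comp (hℓ.measurable j g))
  · by_contra hCne
    obtain ⟨q, hq⟩ : ∃ q, q ∉ C := by simpa [subset_def] using hCne
    obtain ⟨u, hu, huC⟩ := isOpen_pi_iff'.1 hC.1.isOpen_compl q hq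
    obtain ⟨n₀, V₀, T₀, hV₀, hT₀, h₀⟩ := exists_isOpen_stickMeasure_mem (hu 0).1 ⟨_, (hu 0).2⟩
    obtain ⟨n₁, V₁, T₁, hV₁, hT₁, h₁⟩ := exists_isOpen_stickMeasure_mem (hu 1).1 ⟨_, (hu 1).2⟩
    let k := max n₀ n₁
    -- Conditions for group 0 occupy the first block of length `k`, those for group 1 the second.
    let V : ℕ → Set ℝ := fun j => if j < k then V₀ j else V₁ (j - k)
    let T : ℕ → Set Θ := fun j => if j < k then T₀ j else T₁ (j - k)
    let S : Set (ℕ → Fin 2 → ℕ) := {l | (∀ j, j < k → l j 0 = 1 ∧ l j 1 = 0) ∧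
      (∀ j, k ≤ j → j < 2 * k → l j 1 = 1)}
    have hS : MeasurableSet S := by
      have h : ∀ j g (i : ℕ), MeasurableSet {l : ℕ → Fin 2 → ℕ | l j g = i} := fun j g i =>
        measurableSet_eq_fun (f := fun l : ℕ → Fin 2 → ℕ => l j g) (by fun_prop) measurable_const
      refine MeasurableSet.inter ?_ ?_
      · change MeasurableSet {l : ℕ → Fin 2 → ℕ | ∀ j < k, l j 0 = 1 ∧ l j 1 = 0}
        simp only [ofPred_forall]
        exact .iInter fun j => .iInter fun _ => (h j 0 1).inter (h j 1 0)
      · change MeasurableSet {l : ℕ → Fin 2 → ℕ | ∀ j, k ≤ j → j < 2 * k → l j 1 = 1}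
        simp only [ofPred_forall]
        exact .iInter fun j => .iInter fun _ => .iInter fun _ => h j 1 1
    let E : Set Ω := {ω | (fun j g => ℓ j g ω) ∈ S ∧ ∀ j < 2 * k, v j ω ∈ V j ∧ θ j ω ∈ T j}
    have hE : 0 < μ E := hvθ.measure_inter_pos hα hP₀ hind hS (hpos k)
      (fun j => by dsimp only [V]; split_ifs; exacts [hV₀ _, hV₁ _])
      (fun j => by dsimp only [T]; split_ifs; exacts [hT₀ _, hT₁ _]) (2 * k)
    have hEm : MeasurableSet E := by
      have hVo : ∀ j, MeasurableSet (V j) := fun j => by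
        dsimp only [V]; split_ifs; exacts [(hV₀ _).1.measurableSet, (hV₁ _).1.measurableSet]
      have hTo : ∀ j, MeasurableSet (T j) := fun j => by
        dsimp only [T]; split_ifs; exacts [(hT₀ _).1.measurableSet, (hT₁ _).1.measurableSet]
      refine MeasurableSet.inter ((measurable_pi_lambda _ fun j => measurable_pi_lambda _ fun g =>
        hℓ.measurable j g) hS) ?_
      change MeasurableSet {ω | ∀ j < 2 * k, v j ω ∈ V j ∧ θ j ω ∈ T j}
      simp only [ofPred_forall]
      exact .iInter fun j => .iInter fun _ =>
        (hvθ.measurable_v j (hVo j)).inter (hvθ.measurable_θ j (hTo j))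
    have hEC : ∀ᵐ ω ∂μ, ω ∈ E → p ω ∉ C := by
      filter_upwards [h01, hp] with ω hc hpω hωE
      obtain ⟨⟨hl₀, hl₁⟩, hvt⟩ := hωE
      refine huC fun g _ => ?_
      have hn₀ : n₀ ≤ k := le_max_left _ _
      have hn₁ : n₁ ≤ k := le_max_right _ _
      fin_cases g
      · refine h₀ _ _ (hc 0) (fun j hj => ?_) _ (hpω 0)
        have hjk : j < k := hj.trans_le hn₀
        simpa [V, T, hjk, (hl₀ j hjk).1] using hvt j (by omega)
      · have hQ := hpω 1
        rw [thinnedMeasure_eq_stickMeasure, stickMeasure_eq_of_forall_lt_eq_zero (m := k)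
          fun j hj => by simp [(hl₀ j hj).2]] at hQ
        refine h₁ _ _ (fun j => hc 1 (k + j)) (fun j hj => ?_) _ hQ
        simpa [V, T, hl₁ (k + j) (by omega) (by omega)] using hvt (k + j) (by omega)
    -- Only `E` needs to be measurable; `p ⁻¹' C` enters through monotonicity alone.
    have hle : μ (p ⁻¹' C) ≤ μ Eᶜ :=
      measure_mono_ae (hEC.mono fun ω h hω hωE => h hωE hω)
    rw [hC.2, prob_compl_eq_one_sub hEm] at hle
    exact (ENNReal.sub_lt_self ENNReal.one_ne_top one_ne_zero hE.ne').not_ge hle
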